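/- All graphs are finite and simple. For a graph $H$ with $q$ edges, a local antimagic labeling of $H$ is a bijection $f : E(H) \to \{1, \dots, q\}$ such that $f^+(u) \ne f^+(v)$ for any two adjacent vertices $u, v$, where $f^+(u)$ is the sum of $f(e)$ over all edges $e$ incident to $u$. The local antimagic chromatic number $\chi_{la}(H)$ is the minimum number of distinct values of $f^+$ on $V(H)$ over all local antimagic labelings $f$ of $H$ ($\infty$ if there is none). For $t \ge 1$, $O_t$ denotes the null graph with $t$ vertices, and $G[O_t]$ denotes the lexicographic product: its vertex set is $V(G) \times V(O_t)$, and $(u,u')$ is adjacent to $(v,v')$ if and only if $uv \in E(G)$. Theorem. Let $G$ be an Eulerian graph (a connected graph with a closed trail that contains every edge) that is tripartite with partite sets $V_1 = \{w\}$, $V_2$, $V_3$, where $|V_2| \ge 2$ and $|V_3| \ge 2$. Suppose that for some integers $a, b, m, n \ge 0$ the vertex $w$ is adjacent to exactly $2a+1$ vertices of $V_2$ and to exactly $2b+1$ vertices of $V_3$, every vertex of $V_2$ has degree $2m$, and every vertex of $V_3$ has degree $2n$. Then $\chi_{la}(G[O_t]) = 3$ for every integer $t \ge 3$. -/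

import Mathlib

namespace SimpleGraph

/-- The lexicographic product `G[H]`. -/
def lexProduct {V W : Type*} (G : SimpleGraph V) (H : SimpleGraph W) : SimpleGraph (V × W) where
  Adj p q := G.Adj p.1 q.1 ∨ (p.1 = q.1 ∧ H.Adj p.2 q.2)
  symm := ⟨fun _ _ h => h.elim (fun h => Or.inl h.symm) (fun h => Or.inr ⟨h.1.symm, h.2.symm⟩)⟩
  loopless := ⟨fun _ h => h.elim (fun h => h.ne rfl) (fun h => h.2.ne rfl)⟩

/-- The null graph `O_t`: `t` vertices and no edges. -/
def nullGraph (t : ℕ) : SimpleGraph (Fin t) := ⊥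

open Classical in
/-- The induced vertex color `f⁺(u)`, the sum of the labels of the edges incident to `u`. -/
noncomputable def inducedColor {V : Type*} [Fintype V] (G : SimpleGraph V) (f : Sym2 V → ℕ)
    (u : V) : ℕ :=
  ∑ e ∈ G.incidenceFinset u, f e

/-- `f`, restricted to the edges, is a bijection onto `{1, …, q}` with `q` the number of edges,
and adjacent vertices receive distinct induced colors. The values of `f` off the edge set play
no role. -/
structure IsLocalAntimagicLabeling {V : Type*} [Fintype V] (G : SimpleGraph V)
    (f : Sym2 V → ℕ) : Prop where
  bijOn : Set.BijOn f G.edgeSet (Set.Icc 1 G.edgeSet.ncard)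
  color_ne : ∀ ⦃u v : V⦄, G.Adj u v → G.inducedColor f u ≠ G.inducedColor f v

/-- The local antimagic chromatic number: the minimum number of induced colors over all local
antimagic labelings, and `⊤` if there is no such labeling. -/
noncomputable def localAntimagicChromaticNumber {V : Type*} [Fintype V] (G : SimpleGraph V) :
    ℕ∞ :=
  ⨅ (f : Sym2 V → ℕ) (_ : G.IsLocalAntimagicLabeling f),
    ((Set.range (G.inducedColor f)).ncard : ℕ∞)

/-- A connected graph that has a closed trail through every edge. -/
def IsEulerianGraph {V : Type*} [DecidableEq V] (G : SimpleGraph V) : Prop :=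
  G.Connected ∧ ∃ (v : V) (p : G.Walk v v), p.IsEulerian

/-- `G` is Eulerian and tripartite with partite sets `{w}`, `V₂`, `V₃`, where `V₂` and `V₃` have at
least two vertices each; `w` is adjacent to `2a + 1` vertices of `V₂` and to `2b + 1` vertices of
`V₃`; the vertices of `V₂` have degree `2m` and those of `V₃` have degree `2n`. -/
structure IsOddEulerianTripartite {V : Type*} [Fintype V] [DecidableEq V] (G : SimpleGraph V)
    [DecidableRel G.Adj] (w : V) (V₂ V₃ : Finset V) (a b m n : ℕ) : Prop where
  eulerian : G.IsEulerianGraph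
  notMem_left : w ∉ V₂
  notMem_right : w ∉ V₃
  disjoint : Disjoint V₂ V₃
  cover : {w} ∪ V₂ ∪ V₃ = Finset.univ
  indep_left : G.IsIndepSet (V₂ : Set V)
  indep_right : G.IsIndepSet (V₃ : Set V)
  two_le_left : 2 ≤ V₂.card
  two_le_right : 2 ≤ V₃.card
  card_left : (G.neighborFinset w ∩ V₂).card = 2 * a + 1
  card_right : (G.neighborFinset w ∩ V₃).card = 2 * b + 1
  degree_left : ∀ u ∈ V₂, G.degree u = 2 * m
  degree_right : ∀ v ∈ V₃, G.degree v = 2 * n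

end SimpleGraph

/-! Number the `q` edges of `G` by `0, …, q - 1` so that the sum at a vertex depends only on its
partite set. Then replace the edge with number `k` by a `t × t` array, with constant row and column
sums, of the labels `t² k + 1, …, t² k + t²` (`exists_labeling_lexProduct`). The colour of a copy of
`u` depends only on the number sum and the degree of `u`, so at most three colours occur;
congruences keep them apart (`color_left_ne_right` and its companions).

The numbering (`IsParityTrail.exists_numbering`) needs a trail through all edges whose odd positions
lie in `V₂ ∪ {w}` and whose even positions lie in `V₃ ∪ {w}`: along it the numbers `0, q - 1, 1, q -
2, …` have consecutive sums `q - 1` at odd and `q` at even positions. An Euler circuit splits at `w`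
into excursions that alternate between `V₂` and `V₃`. Reversed and reordered where necessary, they
form such a trail because `w` has an odd number of neighbours in `V₂` (`exists_walk_parityLift`).

The trail has odd length, hence so has the Euler circuit, and `G` is not 2-colourable. As induced
colours form a proper colouring, three are needed. -/

namespace SimpleGraph

/-! ### Rearranging an Euler circuit by parity -/

/-- The bipartite double cover of `G`, restricted to the vertices `(u, c)` with `u = w` or with `c`
telling whether `u` lies in `X`. -/
def parityLift {V : Type*} (G : SimpleGraph V) (w : V) (X : Set V) : SimpleGraph (V × Bool) where
  Adj x y := G.Adj x.1 y.1 ∧ x.2 ≠ y.2 ∧ (x.1 ≠ w → (x.2 = true ↔ x.1 ∈ X)) ∧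
    (y.1 ≠ w → (y.2 = true ↔ y.1 ∈ X))
  symm := ⟨fun _ _ h => ⟨h.1.symm, h.2.1.symm, h.2.2.2, h.2.2.1⟩⟩
  loopless := ⟨fun _ h => h.1.ne rfl⟩

section ParityLift

variable {V : Type*} {G : SimpleGraph V} {w : V} {X : Set V}

/-- The edges of `G` below the edges of a walk in the parity lift. -/
def projEdges {x y : V × Bool} (p : (G.parityLift w X).Walk x y) : List (Sym2 V) :=
  p.edges.map (Sym2.map Prod.fst)

@[simp] theorem projEdges_nil {x : V × Bool} :
    projEdges (Walk.nil : (G.parityLift w X).Walk x x) = [] := rfl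

@[simp] theorem projEdges_cons {x y z : V × Bool} (h : (G.parityLift w X).Adj x y)
    (p : (G.parityLift w X).Walk y z) :
    projEdges (Walk.cons h p) = s(x.1, y.1) :: projEdges p := rfl

@[simp] theorem projEdges_append {x y z : V × Bool} (p : (G.parityLift w X).Walk x y)
    (q : (G.parityLift w X).Walk y z) : projEdges (p.append q) = projEdges p ++ projEdges q := by
  simp [projEdges]

@[simp] theorem projEdges_reverse {x y : V × Bool} (p : (G.parityLift w X).Walk x y) :
    projEdges p.reverse = (projEdges p).reverse := by
  simp [projEdges]

/-- The list `L` is, up to order, the list of edges of two closed walks at the two lifts of `w`,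
or of a walk from one lift to the other. -/
def LiftsAtBase (G : SimpleGraph V) (w : V) (X : Set V) (L : List (Sym2 V)) : Prop :=
  (∃ (p : (G.parityLift w X).Walk (w, false) (w, false))
      (q : (G.parityLift w X).Walk (w, true) (w, true)), L.Perm (projEdges p ++ projEdges q)) ∨
    ∃ p : (G.parityLift w X).Walk (w, false) (w, true), L.Perm (projEdges p)

theorem LiftsAtBase.perm {L L' : List (Sym2 V)} (h : LiftsAtBase G w X L) (hL : L'.Perm L) :
    LiftsAtBase G w X L' :=
  h.imp (fun ⟨p, q, h⟩ => ⟨p, q, hL.trans h⟩) (fun ⟨p, h⟩ => ⟨p, hL.trans h⟩)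

/-- A crossing walk toggles the two alternatives: it joins two closed walks into one crossing walk,
and, run backwards, it closes up a crossing walk. -/
theorem LiftsAtBase.append_cross {L : List (Sym2 V)} (hL : LiftsAtBase G w X L)
    (r : (G.parityLift w X).Walk (w, false) (w, true)) :
    LiftsAtBase G w X (projEdges r ++ L) := by
  obtain ⟨p, q, h⟩ | ⟨p, h⟩ := hL
  · refine Or.inr ⟨(p.append r).append q, ?_⟩
    grw [h]
    simp only [projEdges_append, ← List.append_assoc]
    exact List.perm_append_comm.append_right _
  · refine Or.inl ⟨p.append r.reverse, .nil, ?_⟩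
    grw [h]
    simp only [projEdges_append, projEdges_reverse, projEdges_nil, List.append_nil]
    exact List.perm_append_comm.trans ((List.reverse_perm _).symm.append_left _)

theorem LiftsAtBase.append_walk {L : List (Sym2 V)} (hL : LiftsAtBase G w X L) {c d : Bool}
    (r : (G.parityLift w X).Walk (w, c) (w, d)) :
    LiftsAtBase G w X (projEdges r ++ L) := by
  cases c <;> cases d
  · obtain ⟨p, q, h⟩ | ⟨p, h⟩ := hL
    · refine Or.inl ⟨r.append p, q, ?_⟩
      rw [projEdges_append, List.append_assoc]
      exact h.append_left _
    · exact Or.inr ⟨r.append p, by rw [projEdges_append]; exact h.append_left _⟩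
  · exact hL.append_cross r
  · refine (hL.append_cross r.reverse).perm ?_
    rw [projEdges_reverse]
    exact (List.reverse_perm _).symm.append_right _
  · obtain ⟨p, q, h⟩ | ⟨p, h⟩ := hL
    · refine Or.inl ⟨p, q.append r, ?_⟩
      rw [projEdges_append, ← List.append_assoc]
      exact (h.append_left _).trans List.perm_append_comm
    · refine Or.inr ⟨p.append r, ?_⟩
      rw [projEdges_append]
      exact (h.append_left _).trans List.perm_append_comm

-- Away from `w` the colour of a lifted vertex is forced, so every excursion from `w` lifts to a
-- walk between lifts of `w`. In the induction, a walk that starts outside `w` keeps its unfinished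
-- excursion `r` apart from the completed ones in `L`.
open Classical in
theorem exists_lift_of_walk
    (hX : ∀ u v, G.Adj u v → u ≠ w → v ≠ w → (u ∈ X ↔ v ∉ X)) {u z : V} (c : G.Walk u z)
    (hz : z = w) :
    (u = w → LiftsAtBase G w X c.edges) ∧
      (u ≠ w → ∃ (d : Bool) (r : (G.parityLift w X).Walk (u, decide (u ∈ X)) (w, d))
        (L : List (Sym2 V)), LiftsAtBase G w X L ∧ c.edges.Perm (projEdges r ++ L)) := by
  induction c with
  | nil => exact ⟨fun _ => Or.inl ⟨.nil, .nil, by simp⟩, fun h => absurd hz h⟩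
  | @cons u v z h c ih =>
    obtain ⟨ih₁, ih₂⟩ := ih hz
    constructor
    · rintro rfl
      obtain ⟨d, r, L, hL, hc⟩ := ih₂ h.ne'
      have hadj : (G.parityLift u X).Adj (u, !decide (v ∈ X)) (v, decide (v ∈ X)) :=
        ⟨h, by simp, by simp, by simp⟩
      refine (hL.append_walk (Walk.cons hadj r)).perm ?_
      simpa using hc
    · intro hu
      by_cases hv : v = w
      · subst hv
        have hadj : (G.parityLift v X).Adj (u, decide (u ∈ X)) (v, !decide (u ∈ X)) :=
          ⟨h, by simp, by simp, by simp⟩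
        exact ⟨_, Walk.cons hadj .nil, c.edges, ih₁ rfl, by simp⟩
      · obtain ⟨d, r, L, hL, hc⟩ := ih₂ hv
        have hadj : (G.parityLift w X).Adj (u, decide (u ∈ X)) (v, decide (v ∈ X)) :=
          ⟨h, by have := hX u v h hu hv; simp [this], by simp, by simp⟩
        exact ⟨d, Walk.cons hadj r, L, hL, by simpa using hc⟩

theorem Walk.countP_edges_add_mod_two {W : Type*} [DecidableEq W] {H : SimpleGraph W}
    {x y : W} (p : H.Walk x y) (z : W) :
    (p.edges.countP (z ∈ ·) + (if x = z then 1 else 0) + (if y = z then 1 else 0)) % 2 = 0 := by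
  induction p with
  | nil => simp only [Walk.edges_nil, List.countP_nil]; split_ifs <;> rfl
  | @cons x y t h p ih =>
    have := h.ne
    simp only [Walk.edges_cons, List.countP_cons, Sym2.mem_iff, decide_eq_true_eq]
    split_ifs at * <;> grind

-- A neighbour of `(w, false)` in the lift has colour `true`, hence lies over `X`; a neighbour of
-- `(w, true)` does not.
open Classical in
theorem countP_projEdges {x y : V × Bool} (p : (G.parityLift w X).Walk x y) :
    (projEdges p).countP (fun e => w ∈ e ∧ ∃ x ∈ X, x ≠ w ∧ x ∈ e) =
      p.edges.countP ((w, false) ∈ ·) := by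
  rw [projEdges, List.countP_map]
  refine List.countP_congr fun e he => ?_
  have he' := p.edges_subset_edgeSet he
  induction e with | _ u v
  obtain ⟨u, c⟩ := u
  obtain ⟨v, d⟩ := v
  obtain ⟨h₁, h₂, h₃, h₄⟩ := he'
  have := h₁.ne
  simp only [Function.comp, Sym2.map_mk, Sym2.mem_iff, Prod.mk.injEq, decide_eq_true_eq] at *
  grind

open Classical in
/-- A closed walk at `w`, the number of whose edges between `w` and `X` is odd, can be rearranged
to a walk from `(w, false)` to `(w, true)` in the parity lift. -/
theorem exists_walk_parityLift
    (hX : ∀ u v, G.Adj u v → u ≠ w → v ≠ w → (u ∈ X ↔ v ∉ X)) (c : G.Walk w w)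
    (hodd : Odd (c.edges.countP (fun e => w ∈ e ∧ ∃ x ∈ X, x ≠ w ∧ x ∈ e))) :
    ∃ p : (G.parityLift w X).Walk (w, false) (w, true), c.edges.Perm (projEdges p) := by
  refine ((exists_lift_of_walk hX c rfl).1 rfl).resolve_left ?_
  -- Closed walks meet `(w, false)` in an even number of edges, against `hodd`.
  rintro ⟨p, q, h⟩
  rw [h.countP_eq, List.countP_append, countP_projEdges, countP_projEdges] at hodd
  have h₁ := p.countP_edges_add_mod_two (w, false)
  have h₂ := q.countP_edges_add_mod_two (w, false)
  simp only [↓reduceIte, Prod.mk.injEq, true_and, Bool.true_eq_false] at h₁ h₂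
  rw [Nat.odd_iff] at hodd
  omega

theorem Walk.getVert_parityLift_snd {x y : V × Bool} (p : (G.parityLift w X).Walk x y) {i : ℕ}
    (hi : i ≤ p.length) : (p.getVert i).2 = (x.2 ^^ decide (i % 2 = 1)) := by
  induction i with
  | zero => simp
  | succ i ih =>
    have h := (p.adj_getVert_succ (i := i) (by omega)).2.1
    rw [ih (by omega)] at h
    rcases Nat.mod_two_eq_zero_or_one i with h' | h' <;>
      simp [h', Nat.add_mod] at h ⊢ <;> grind

end ParityLift

/-! ### Zigzag numbering along the trail -/

section Numbering

variable {V : Type*} {G : SimpleGraph V} {w : V} {X : Set V}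

/-- At an interior visit to `z` the terms of the two adjacent steps cancel, so only the ends remain.
The second sum corrects for steps from `z` to itself, and `l n` belongs to a fictitious step after
the last. -/
theorem sum_range_alternating {W : Type*} [DecidableEq W] (x : ℕ → W) (z : W) (l : ℕ → ℤ) (s : ℤ)
    (n : ℕ) (h : ∀ i < n, x (i + 1) = z → l i + l (i + 1) = s) :
    ∑ i ∈ Finset.range n, (if x i = z ∨ x (i + 1) = z then 2 * l i - s else 0) +
      ∑ i ∈ Finset.range n, (if x i = z ∧ x (i + 1) = z then 2 * l i - s else 0) =
      (if x 0 = z then 2 * l 0 - s else 0) - (if x n = z then 2 * l n - s else 0) := by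
  induction n with
  | zero => simp
  | succ n ih =>
    have ih := ih fun i hi => h i (by omega)
    have := h n (by omega)
    rw [Finset.sum_range_succ, Finset.sum_range_succ]
    split_ifs at * <;> grind

/-- The sequence `x` runs through a walk in the parity lift of `G` that covers each edge of `G`
exactly once. -/
structure IsParityTrail (G : SimpleGraph V) (w : V) (X : Set V) (q : ℕ) (x : ℕ → V × Bool) :
    Prop where
  zero : x 0 = (w, false)
  last : x q = (w, true)
  color : ∀ i ≤ q, (x i).2 = decide (i % 2 = 1)
  adj : ∀ i < q, (G.parityLift w X).Adj (x i) (x (i + 1))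
  bijOn : Set.BijOn (fun i => s((x i).1, (x (i + 1)).1)) (Set.Iio q) G.edgeSet

theorem IsParityTrail.odd {q : ℕ} {x : ℕ → V × Bool} (h : G.IsParityTrail w X q x) :
    q % 2 = 1 := by
  simpa [h.last] using h.color q le_rfl

theorem isParityTrail_of_perm {c : G.Walk w w} [DecidableEq V] (hc : c.IsEulerian)
    {p : (G.parityLift w X).Walk (w, false) (w, true)} (hp : c.edges.Perm (projEdges p)) :
    G.IsParityTrail w X p.length p.getVert := by
  have hget : ∀ i (hi : i < (projEdges p).length),
      (projEdges p)[i] = s((p.getVert i).1, (p.getVert (i + 1)).1) := by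
    intro i hi
    simp only [projEdges, List.getElem_map, Walk.getElem_edges, Sym2.map_mk]
  have hlen : (projEdges p).length = p.length := by simp [projEdges]
  have hnd : (projEdges p).Nodup := hp.nodup_iff.1 hc.isTrail.edges_nodup
  have hmem : ∀ e, e ∈ projEdges p ↔ e ∈ G.edgeSet := fun e => by
    rw [← hp.mem_iff, hc.mem_edges_iff]
  refine ⟨by simp, by simp, fun i hi => by simp [p.getVert_parityLift_snd hi],
    fun i hi => p.adj_getVert_succ hi, ?_, ?_, ?_⟩
  · intro i hi
    exact (p.adj_getVert_succ hi).1
  · intro i hi j hj hij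
    simp only [Set.mem_Iio, ← hlen] at hi hj
    simp only [← hget i hi, ← hget j hj] at hij
    exact (hnd.getElem_inj_iff).1 hij
  · intro e he
    obtain ⟨i, hi, rfl⟩ := List.mem_iff_getElem.1 ((hmem e).2 he)
    exact ⟨i, by simpa [hlen] using hi, (hget i hi).symm⟩

variable {q : ℕ} {x : ℕ → V × Bool}

-- An edge of `G` has at most one lift, since one of its ends is not `w` and the colour of that end
-- is forced. The edges at `(u, c)` are therefore exactly the trail steps that meet `(u, c)`.
open Classical in
theorem IsParityTrail.sum_neighbors [Fintype V] (h : G.IsParityTrail w X q x) (F : Sym2 V → ℤ)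
    (u : V) (c : Bool) :
    ∑ v with (G.parityLift w X).Adj (u, c) (v, !c), F s(u, v) =
      ∑ i ∈ Finset.range q, if x i = (u, c) ∨ x (i + 1) = (u, c) then
        F s((x i).1, (x (i + 1)).1) else 0 := by
  rw [← Finset.sum_filter]
  symm
  have key : ∀ i < q, ∀ v, (x i = (u, c) ∨ x (i + 1) = (u, c)) →
      s((x i).1, (x (i + 1)).1) = s(u, v) → (G.parityLift w X).Adj (u, c) (v, !c) := by
    intro i hi v hz he
    have ha := h.adj i hi
    obtain ⟨h₁, h₂, h₃, h₄⟩ := ha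
    have := h₁.ne
    generalize x i = y at *
    generalize x (i + 1) = z at *
    obtain ⟨y, d⟩ := y
    obtain ⟨z, d'⟩ := z
    have h₅ := h₁.symm
    simp only [Prod.mk.injEq, Sym2.eq_iff, parityLift] at *
    grind
  have key' : ∀ i < q, ∀ v, (G.parityLift w X).Adj (u, c) (v, !c) →
      s((x i).1, (x (i + 1)).1) = s(u, v) → x i = (u, c) ∨ x (i + 1) = (u, c) := by
    intro i hi v ha' he
    have ha := h.adj i hi
    obtain ⟨h₁, h₂, h₃, h₄⟩ := ha
    obtain ⟨h₅, h₆, h₇, h₈⟩ := ha'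
    have := h₁.ne
    generalize x i = y at *
    generalize x (i + 1) = z at *
    obtain ⟨y, d⟩ := y
    obtain ⟨z, d'⟩ := z
    simp only [Prod.mk.injEq, Sym2.eq_iff] at he ⊢
    clear key
    have := h₅.ne
    by_cases hu : u = w <;> by_cases hv : v = w <;> cases c <;> cases d <;> cases d' <;> grind
  refine Finset.sum_bij
    (fun i _ => if (x i).1 = u then (x (i + 1)).1 else (x i).1) ?_ ?_ ?_ ?_
  · intro i hi
    simp only [Finset.mem_filter, Finset.mem_range, Finset.mem_univ, true_and] at hi ⊢
    refine key i hi.1 _ hi.2 ?_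
    split_ifs with hu
    · rw [hu]
    · have : (x (i + 1)).1 = u := by
        rcases hi.2 with h' | h'
        · simp [h'] at hu
        · simp [h']
      rw [this, Sym2.eq_swap]
  · intro i hi j hj hij
    simp only [Finset.mem_filter, Finset.mem_range] at hi hj
    refine h.bijOn.injOn hi.1 hj.1 ?_
    simp only [Sym2.eq_iff]
    have h₁ := hi.2
    have h₂ := hj.2
    generalize x i = y at *
    generalize x (i + 1) = z at *
    generalize x j = y' at *
    generalize x (j + 1) = z' at *
    grind
  · intro v hv
    simp only [Finset.mem_filter, Finset.mem_univ, true_and] at hv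
    obtain ⟨i, hi, he⟩ := h.bijOn.surjOn (show s(u, v) ∈ G.edgeSet from hv.1)
    refine ⟨i, by simpa using ⟨hi, key' i hi v hv he⟩, ?_⟩
    simp only [Sym2.eq_iff] at he
    have := hv.1.ne
    simp only at this
    grind
  · intro i hi
    simp only [Finset.mem_filter, Finset.mem_range] at hi
    congr 1
    split_ifs with hu
    · rw [hu]
    · have : (x (i + 1)).1 = u := by
        rcases hi.2 with h' | h'
        · simp [h'] at hu
        · simp [h']
      rw [this, Sym2.eq_swap]

/-- The number on the `i`-th edge of a trail of `q` edges: `0, q - 1, 1, q - 2, …`. -/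
def zigzag (q i : ℕ) : ℕ := if i % 2 = 0 then i / 2 else q - 1 - i / 2

theorem zigzag_bijOn {q : ℕ} (hq : q % 2 = 1) :
    Set.BijOn (zigzag q) (Set.Iio q) (Set.Iio q) := by
  refine ⟨fun i hi => ?_, fun i hi j hj hij => ?_, fun y hy => ?_⟩
  · simp only [Set.mem_Iio, zigzag] at *
    split_ifs <;> omega
  · simp only [Set.mem_Iio, zigzag] at *
    split_ifs at * <;> omega
  · simp only [Set.mem_Iio] at hy
    by_cases h : y ≤ q / 2
    · exact ⟨2 * y, by simp only [Set.mem_Iio]; omega, by simp [zigzag]⟩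
    · refine ⟨2 * (q - 1 - y) + 1, by simp only [Set.mem_Iio]; omega, ?_⟩
      simp only [zigzag]
      split_ifs <;> omega

open Classical in
/-- Numbering the edges along the trail in zigzag order makes the sum at each vertex of the lift
proportional to the degree, up to boundary terms. -/
theorem IsParityTrail.exists_numbering [Fintype V] (h : G.IsParityTrail w X q x) :
    ∃ k : Sym2 V → ℕ, Set.BijOn k G.edgeSet (Set.Iio q) ∧
      ∀ (u : V) (c : Bool), ∑ v with (G.parityLift w X).Adj (u, c) (v, !c),
          (2 * (k s(u, v) : ℤ) - (if c then (q : ℤ) - 1 else q)) =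
        if u = w ∧ c = false then -(q : ℤ) else 0 := by
  have hq := h.odd
  set e : ℕ → Sym2 V := fun i => s((x i).1, (x (i + 1)).1) with he
  have hinv := h.bijOn.invOn_invFunOn
  refine ⟨zigzag q ∘ Function.invFunOn e (Set.Iio q),
    (zigzag_bijOn hq).comp (hinv.symm.bijOn ?_ ?_), fun u c => ?_⟩
  · exact h.bijOn.surjOn.mapsTo_invFunOn
  · exact h.bijOn.mapsTo
  · refine (h.sum_neighbors (fun f =>
      2 * ((zigzag q ∘ Function.invFunOn e (Set.Iio q)) f : ℤ) - (if c then (q : ℤ) - 1 else q))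
      u c).trans ?_
    have key := sum_range_alternating x (u, c) (fun i => (zigzag q i : ℤ))
      (if c then (q : ℤ) - 1 else q) q ?_
    · have h0 : ∑ i ∈ Finset.range q, (if x i = (u, c) ∧ x (i + 1) = (u, c) then
          2 * (zigzag q i : ℤ) - (if c then (q : ℤ) - 1 else q) else 0) = 0 := by
        refine Finset.sum_eq_zero fun i hi => if_neg ?_
        rintro ⟨h₁, h₂⟩
        exact (h.adj i (Finset.mem_range.1 hi)).ne (h₁.trans h₂.symm)
      rw [h0, add_zero] at key
      refine Eq.trans (Finset.sum_congr rfl fun i hi => ?_) (key.trans ?_)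
      · have : Function.invFunOn e (Set.Iio q) s((x i).1, (x (i + 1)).1) = i :=
          hinv.1 (by simpa using hi)
        simp only [Function.comp, this]
      -- The fictitious last number is `(q - 1) / 2`, so the end at `(w, true)` contributes nothing;
      -- the start at `(w, false)` contributes `2 * 0 - q`.
      · have hz : (zigzag q q : ℤ) * 2 = q - 1 := by
          simp only [zigzag]
          split_ifs <;> omega
        have hz0 : zigzag q 0 = 0 := by simp [zigzag]
        rw [h.zero, h.last]
        simp only [Prod.mk.injEq, hz0]
        cases c <;> by_cases hu : u = w <;> simp [hu, eq_comm] <;> grind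
    -- The colour of a position is its parity, and so decides between the consecutive sums `q - 1`
    -- and `q`.
    · intro i hi hx
      have hc := h.color (i + 1) (by omega)
      simp only [hx] at hc
      subst hc
      simp only [zigzag, decide_eq_true_eq]
      split_ifs <;> omega

end Numbering

end SimpleGraph

/-! ### Semimagic squares of every order from 3 on -/

/-- There is a square array, with rows and columns indexed by `ι`, that contains each of the numbers
`0, …, t² - 1` once, `t` the cardinality of `ι`, and has constant row and column sums. -/
def HasSemimagicSquare (ι : Type*) [Fintype ι] : Prop :=
  ∃ S : ι → ι → ℕ, (∀ i j, S i j < Fintype.card ι ^ 2) ∧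
    (∀ i j i' j', S i j = S i' j' → i = i' ∧ j = j') ∧
    (∀ i, 2 * ∑ j, S i j + Fintype.card ι = Fintype.card ι ^ 3) ∧
    ∀ j, 2 * ∑ i, S i j + Fintype.card ι = Fintype.card ι ^ 3

namespace HasSemimagicSquare

theorem of_equiv {ι κ : Type*} [Fintype ι] [Fintype κ] (e : ι ≃ κ) (h : HasSemimagicSquare ι) :
    HasSemimagicSquare κ := by
  obtain ⟨S, h₁, h₂, h₃, h₄⟩ := h
  rw [Fintype.card_congr e] at *
  refine ⟨fun i j => S (e.symm i) (e.symm j), fun i j => h₁ _ _, fun i j i' j' h => ?_,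
    fun i => ?_, fun j => ?_⟩
  · simpa using h₂ _ _ _ _ h
  · rw [← h₃ (e.symm i), ← Equiv.sum_comp e.symm]
  · rw [← h₄ (e.symm j), ← Equiv.sum_comp e.symm (fun i => S i (e.symm j))]

theorem of_card_eq {ι κ : Type*} [Fintype ι] [Fintype κ] (hc : Fintype.card ι = Fintype.card κ)
    (h : HasSemimagicSquare ι) : HasSemimagicSquare κ :=
  h.of_equiv (Fintype.equivOfCardEq hc)

theorem zmod_sum_val (t : ℕ) [NeZero t] : 2 * ∑ d : ZMod t, d.val + t = t ^ 2 := by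
  obtain ⟨s, rfl⟩ : ∃ s, t = s + 1 := ⟨t - 1, by have := NeZero.pos t; omega⟩
  have h : ∑ d : ZMod (s + 1), d.val = ∑ d ∈ Finset.range (s + 1), d :=
    Fin.sum_univ_eq_sum_range (fun d => d) (s + 1)
  rw [h, mul_comm 2, Finset.sum_range_id_mul_two]
  simp
  ring

/-- The base-`t` digits `i + j` and `i - j` determine `i` and `j` because `2` is invertible modulo
`t`, and each digit runs through all residues along every row and column. -/
theorem zmod_of_odd {t : ℕ} [NeZero t] (ht : Odd t) : HasSemimagicSquare (ZMod t) := by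
  have hpos : 0 < t := NeZero.pos t
  have h2 : IsUnit (2 : ZMod t) := by
    have : IsUnit ((2 : ℕ) : ZMod t) := (ZMod.isUnit_iff_coprime 2 t).2 (by simpa using ht)
    simpa using this
  have hs := zmod_sum_val t
  have e₁ (i : ZMod t) : ∑ j, (i + j).val = ∑ d : ZMod t, d.val :=
    Equiv.sum_comp (Equiv.addLeft i) ZMod.val
  have e₂ (i : ZMod t) : ∑ j, (i - j).val = ∑ d : ZMod t, d.val :=
    Equiv.sum_comp (Equiv.subLeft i) ZMod.val
  have e₃ (j : ZMod t) : ∑ i, (i + j).val = ∑ d : ZMod t, d.val :=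
    Equiv.sum_comp (Equiv.addRight j) ZMod.val
  have e₄ (j : ZMod t) : ∑ i, (i - j).val = ∑ d : ZMod t, d.val :=
    Equiv.sum_comp (Equiv.subRight j) ZMod.val
  refine ⟨fun i j => t * (i + j).val + (i - j).val, fun i j => ?_, fun i j i' j' h => ?_,
    fun i => ?_, fun j => ?_⟩
  · have h₁ := ZMod.val_lt (i + j)
    have h₂ := ZMod.val_lt (i - j)
    rw [ZMod.card]
    nlinarith
  · have h₁ := ZMod.val_lt (i - j)
    have h₂ := ZMod.val_lt (i' - j')
    have a := congrArg (· / t) h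
    have b := congrArg (· % t) h
    simp only [Nat.mul_add_div hpos, Nat.div_eq_of_lt h₁, Nat.div_eq_of_lt h₂, add_zero] at a
    simp only [Nat.mul_add_mod, Nat.mod_eq_of_lt h₁, Nat.mod_eq_of_lt h₂] at b
    replace a := ZMod.val_injective t a
    replace b := ZMod.val_injective t b
    constructor
    · exact h2.mul_left_cancel (by linear_combination a + b)
    · exact h2.mul_left_cancel (by linear_combination a - b)
  · rw [Finset.sum_add_distrib, ← Finset.mul_sum, e₁, e₂, ZMod.card]
    nlinarith
  · rw [Finset.sum_add_distrib, ← Finset.mul_sum, e₃, e₄, ZMod.card]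
    nlinarith

/-- A sequence of `2 × 2` blocks, each with the entries `0, 1, 2, 3`, whose two rows, and whose two
columns, have equal total sums over the first `s` blocks. -/
theorem exists_balanced_blocks (s : ℕ) (hs : 2 ≤ s) : ∃ P : ℕ → Fin 2 → Fin 2 → ℕ,
    (∀ d x y, P d x y < 4) ∧ (∀ d x y x' y', P d x y = P d x' y' → x = x' ∧ y = y') ∧
    (∀ x, ∑ d ∈ Finset.range s, ∑ y, P d x y = 3 * s) ∧
    ∀ y, ∑ d ∈ Finset.range s, ∑ x, P d x y = 3 * s := by
  obtain ⟨s, rfl⟩ := Nat.exists_eq_add_of_le' hs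
  clear hs
  induction s using Nat.twoStepInduction with
  | zero =>
    refine ⟨fun d => if d = 0 then ![![0, 1], ![2, 3]] else ![![3, 2], ![1, 0]], ?_, ?_, ?_, ?_⟩
    · intro d
      by_cases h : d = 0 <;> simp only [h, if_true, if_false] <;> decide
    · intro d
      by_cases h : d = 0 <;> simp only [h, if_true, if_false] <;> decide
    · decide
    · decide
  | one =>
    refine ⟨fun d => if d = 0 then ![![0, 3], ![2, 1]] else if d = 1 then ![![1, 0], ![3, 2]]
      else ![![3, 2], ![0, 1]], ?_, ?_, ?_, ?_⟩
    · intro d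
      by_cases h : d = 0
      · simp only [h, if_true]; decide
      by_cases h' : d = 1 <;> simp only [h, h', if_true, if_false] <;> decide
    · intro d
      by_cases h : d = 0
      · simp only [h, if_true]; decide
      by_cases h' : d = 1 <;> simp only [h, h', if_true, if_false] <;> decide
    · decide
    · decide
  -- Two complementary blocks are balanced by themselves and can be put in front.
  | more s ih _ =>
    obtain ⟨P, h₁, h₂, h₃, h₄⟩ := ih
    refine ⟨fun d => match d with
      | 0 => ![![0, 1], ![2, 3]]
      | 1 => ![![3, 2], ![1, 0]]
      | d + 2 => P d, ?_, ?_, fun x => ?_, fun y => ?_⟩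
    · rintro (_ | _ | d)
      · dsimp only; decide
      · dsimp only [zero_add]; decide
      · exact h₁ d
    · rintro (_ | _ | d)
      · dsimp only; decide
      · dsimp only [zero_add]; decide
      · exact h₂ d
    · rw [Finset.sum_range_succ', Finset.sum_range_succ']
      simp only [h₃]
      fin_cases x <;> simp [Fin.sum_univ_two] <;> ring
    · rw [Finset.sum_range_succ', Finset.sum_range_succ']
      simp only [h₄]
      fin_cases y <;> simp [Fin.sum_univ_two] <;> ring

/-- Each entry of `S` is blown up to a `2 × 2` block. The pattern depends on `j - i` modulo `s`, so
every row and column of `S` uses each of `P 0, …, P (s - 1)` once. -/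
theorem double {s : ℕ} [NeZero s] (hs : 2 ≤ s) (h : HasSemimagicSquare (Fin s)) :
    HasSemimagicSquare (Fin s × Fin 2) := by
  obtain ⟨S, h₁, h₂, h₃, h₄⟩ := h
  obtain ⟨P, p₁, p₂, p₃, p₄⟩ := exists_balanced_blocks s hs
  simp only [Fintype.card_fin] at h₁ h₃ h₄
  refine ⟨fun a b => 4 * S a.1 b.1 + P (b.1 - a.1).val a.2 b.2, ?_, ?_, ?_, ?_⟩
  · rintro ⟨i, x⟩ ⟨j, y⟩
    have := h₁ i j
    have := p₁ (j - i).val x y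
    simp only [Fintype.card_prod, Fintype.card_fin]
    nlinarith
  · rintro ⟨i, x⟩ ⟨j, y⟩ ⟨i', x'⟩ ⟨j', y'⟩ h
    simp only at h
    have a₁ := p₁ (j - i).val x y
    have a₂ := p₁ (j' - i').val x' y'
    obtain ⟨rfl, rfl⟩ := h₂ i j i' j' (by omega)
    obtain ⟨rfl, rfl⟩ := p₂ (j - i).val x y x' y' (by omega)
    exact ⟨rfl, rfl⟩
  · rintro ⟨i, x⟩
    have hP : ∑ j : Fin s, ∑ y, P (j - i).val x y = 3 * s := by
      rw [← p₃ x, ← Fin.sum_univ_eq_sum_range (fun d => ∑ y, P d x y),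
        ← Equiv.sum_comp (Equiv.subRight i) (fun d : Fin s => ∑ y, P d.val x y)]
      rfl
    have := h₃ i
    simp only [Fintype.card_prod, Fintype.card_fin, Fintype.sum_prod_type, Finset.sum_add_distrib,
      hP, Finset.sum_const, Finset.card_univ, smul_eq_mul, ← Finset.mul_sum]
    nlinarith
  · rintro ⟨j, y⟩
    have hP : ∑ i : Fin s, ∑ x, P (j - i).val x y = 3 * s := by
      rw [← p₄ y, ← Fin.sum_univ_eq_sum_range (fun d => ∑ x, P d x y),
        ← Equiv.sum_comp (Equiv.subLeft j) (fun d : Fin s => ∑ x, P d.val x y)]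
      rfl
    have := h₄ j
    simp only [Fintype.card_prod, Fintype.card_fin, Fintype.sum_prod_type, Finset.sum_add_distrib,
      hP, Finset.sum_const, Finset.card_univ, smul_eq_mul, ← Finset.mul_sum]
    nlinarith

theorem fin_four : HasSemimagicSquare (Fin 4) :=
  ⟨![![0, 14, 13, 3], ![11, 5, 6, 8], ![7, 9, 10, 4], ![12, 2, 1, 15]], by decide, by decide,
    by decide, by decide⟩

/-- Even orders are halved; order `4` is given explicitly because there is no square of order `2` to
double. -/
theorem fin (t : ℕ) (ht : 3 ≤ t) : HasSemimagicSquare (Fin t) := by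
  induction t using Nat.strong_induction_on with
  | _ t ih =>
    have : NeZero t := ⟨by omega⟩
    rcases Nat.even_or_odd t with he | ho
    · obtain ⟨s, rfl⟩ := he.exists_two_nsmul
      rw [smul_eq_mul] at *
      by_cases hs : s = 2
      · subst hs
        exact fin_four
      · have : NeZero s := ⟨by omega⟩
        exact (double (by omega) (ih s (by omega) (by omega))).of_card_eq (by simp [mul_comm])
    · exact (zmod_of_odd ho).of_card_eq (by simp)

end HasSemimagicSquare

namespace SimpleGraph

/-! ### Labelling the lexicographic product -/

section Lex

variable {V : Type*} {G : SimpleGraph V}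

open Classical in
theorem inducedColor_eq_sum [Fintype V] (f : Sym2 V → ℕ) (u : V) :
    G.inducedColor f u = ∑ v with G.Adj u v, f s(u, v) := by
  rw [inducedColor]
  symm
  refine Finset.sum_bij (fun v _ => s(u, v)) ?_ ?_ ?_ ?_
  · intro v hv
    simpa [mem_incidenceFinset, mk'_mem_incidenceSet_iff] using hv
  · intro v _ v' _ h
    exact (Sym2.congr_right).1 h
  · intro e he
    rw [mem_incidenceFinset] at he
    obtain ⟨v, rfl⟩ := he.2
    exact ⟨v, by simpa using he.1, rfl⟩
  · simp

/-- The value on an edge of `G[O_t]` of the labelling that refines the edge numbering `k` of `G` by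
the square array `S`; the bijection `r` serves to orient the edges of `G`. -/
def lexLabel {t : ℕ} (r : V → ℕ) (k : Sym2 V → ℕ) (S : Fin t → Fin t → ℕ) :
    Sym2 (V × Fin t) → ℕ :=
  Sym2.lift ⟨fun x y => t ^ 2 * k s(x.1, y.1) + (if r x.1 < r y.1 then S x.2 y.2
    else if r y.1 < r x.1 then S y.2 x.2 else 0) + 1, fun x y => by
      beta_reduce
      rw [Sym2.eq_swap (a := x.1)]
      split_ifs <;> first | rfl | omega⟩

theorem lexProduct_nullGraph_adj {t : ℕ} {x y : V × Fin t} :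
    (G.lexProduct (nullGraph t)).Adj x y ↔ G.Adj x.1 y.1 := by
  simp [lexProduct, nullGraph]

-- The labels between `(u, i)` and the copies of a neighbour `v` form a row or a column of one
-- array, according to the orientation of `uv`; both have the same sum. Doubling clears the half in
-- `t (t² + 1) / 2`.
open Classical in
theorem exists_labeling_lexProduct [Fintype V] {k : Sym2 V → ℕ} {q t : ℕ}
    (hk : Set.BijOn k G.edgeSet (Set.Iio q)) (ht : 3 ≤ t) :
    ∃ f : Sym2 (V × Fin t) → ℕ,
      Set.BijOn f (G.lexProduct (nullGraph t)).edgeSet (Set.Icc 1 (t ^ 2 * q)) ∧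
      ∀ (u : V) (i : Fin t), 2 * (G.lexProduct (nullGraph t)).inducedColor f (u, i) =
        ∑ v with G.Adj u v, (2 * t ^ 3 * k s(u, v) + t * (t ^ 2 + 1)) := by
  obtain ⟨S, hS, hinj, hrow, hcol⟩ := HasSemimagicSquare.fin t ht
  simp only [Fintype.card_fin] at hS hrow hcol
  set r : V → ℕ := fun v => Fintype.equivFin V v with hr
  have hrinj : Function.Injective r :=
    Fin.val_injective.comp (Fintype.equivFin V).injective
  have htpos : 0 < t ^ 2 := by positivity
  have hval : ∀ {x y : V × Fin t}, r x.1 < r y.1 →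
      lexLabel r k S s(x, y) = t ^ 2 * k s(x.1, y.1) + S x.2 y.2 + 1 := by
    intro x y h
    simp [lexLabel, h]
  have horient : ∀ e ∈ (G.lexProduct (nullGraph t)).edgeSet, ∃ x y, e = s(x, y) ∧
      r x.1 < r y.1 ∧ G.Adj x.1 y.1 := by
    intro e
    induction e with | _ x y
    intro h
    rw [mem_edgeSet, lexProduct_nullGraph_adj] at h
    rcases lt_or_gt_of_ne (hrinj.ne h.ne) with h' | h'
    · exact ⟨x, y, rfl, h', h⟩
    · exact ⟨y, x, Sym2.eq_swap, h', h.symm⟩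
  refine ⟨lexLabel r k S, ⟨?_, ?_, ?_⟩, ?_⟩
  · intro e he
    obtain ⟨x, y, rfl, hxy, h⟩ := horient e he
    have h₁ := hS x.2 y.2
    have h₂ : k s(x.1, y.1) < q := hk.mapsTo h
    rw [hval hxy, Set.mem_Icc]
    refine ⟨by omega, ?_⟩
    nlinarith
  · intro e he e' he' hee
    obtain ⟨x, y, rfl, hxy, h⟩ := horient e he
    obtain ⟨x', y', rfl, hxy', h'⟩ := horient e' he'
    rw [hval hxy, hval hxy'] at hee
    replace hee := Nat.succ_injective hee
    have h₁ := hS x.2 y.2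
    have h₂ := hS x'.2 y'.2
    -- The quotient by `t ^ 2` recovers the edge of `G`, the remainder the cell of the square.
    have a := congrArg (· / t ^ 2) hee
    have b := congrArg (· % t ^ 2) hee
    simp only [Nat.mul_add_div htpos, Nat.div_eq_of_lt h₁, Nat.div_eq_of_lt h₂, add_zero] at a
    simp only [Nat.mul_add_mod, Nat.mod_eq_of_lt h₁, Nat.mod_eq_of_lt h₂] at b
    have c := hk.injOn (show s(x.1, y.1) ∈ G.edgeSet from h)
      (show s(x'.1, y'.1) ∈ G.edgeSet from h') a
    obtain ⟨c₁, c₂⟩ := hinj _ _ _ _ b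
    rcases Sym2.eq_iff.1 c with ⟨d₁, d₂⟩ | ⟨d₁, d₂⟩
    · rw [Prod.ext d₁ c₁, Prod.ext d₂ c₂]
    · rw [d₁, d₂] at hxy
      omega
  · intro N hN
    rw [Set.mem_Icc] at hN
    have hlt : (N - 1) / t ^ 2 < q := Nat.div_lt_of_lt_mul (by omega)
    obtain ⟨e, he, hke⟩ := hk.surjOn hlt
    have hsurj : Function.Surjective
        (fun p : Fin t × Fin t => (⟨S p.1 p.2, hS _ _⟩ : Fin (t ^ 2))) := by
      refine ((Fintype.bijective_iff_injective_and_card _).2 ⟨?_, ?_⟩).2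
      · intro p p' h
        obtain ⟨h₁, h₂⟩ := hinj _ _ _ _ (Fin.mk.inj h)
        exact Prod.ext h₁ h₂
      · simp [sq]
    obtain ⟨⟨i, j⟩, hij⟩ := hsurj ⟨(N - 1) % t ^ 2, Nat.mod_lt _ htpos⟩
    replace hij := Fin.mk.inj hij
    have : ∃ u v, e = s(u, v) ∧ r u < r v := by
      induction e with | _ u v
      rcases lt_or_gt_of_ne (hrinj.ne (G.ne_of_adj he)) with h' | h'
      · exact ⟨u, v, rfl, h'⟩
      · exact ⟨v, u, Sym2.eq_swap, h'⟩
    obtain ⟨u, v, rfl, huv⟩ := this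
    refine ⟨s((u, i), (v, j)), lexProduct_nullGraph_adj.2 he, ?_⟩
    rw [hval huv]
    simp only at hij ⊢
    rw [hij, hke, Nat.div_add_mod]
    omega
  · intro u i
    rw [inducedColor_eq_sum]
    have hset : (Finset.univ.filter fun y : V × Fin t =>
        (G.lexProduct (nullGraph t)).Adj (u, i) y) =
        (Finset.univ.filter fun v => G.Adj u v) ×ˢ Finset.univ := by
      ext y
      simp [lexProduct_nullGraph_adj]
    rw [hset, Finset.sum_product, Finset.mul_sum]
    refine Finset.sum_congr rfl fun v hv => ?_
    have huv : G.Adj u v := by simpa using hv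
    rcases lt_or_gt_of_ne (hrinj.ne huv.ne) with h | h
    · have : ∀ j, lexLabel r k S s((u, i), (v, j)) = t ^ 2 * k s(u, v) + S i j + 1 :=
        fun j => hval h
      simp only [this, Finset.sum_add_distrib, Finset.sum_const, Finset.card_univ,
        Fintype.card_fin, smul_eq_mul]
      linear_combination hrow i
    · have : ∀ j, lexLabel r k S s((u, i), (v, j)) = t ^ 2 * k s(u, v) + S j i + 1 := by
        intro j
        rw [Sym2.eq_swap, hval h, Sym2.eq_swap]
      simp only [this, Finset.sum_add_distrib, Finset.sum_const, Finset.card_univ,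
        Fintype.card_fin, smul_eq_mul]
      linear_combination hcol i

end Lex

/-! ### The lower bound -/

/-- The induced colours on the layer `(v, 0)` properly colour `G`, so with at most two of them every
closed walk would be even. -/
theorem three_le_localAntimagicChromaticNumber_lexProduct {V : Type*} [Fintype V]
    {G : SimpleGraph V} {t : ℕ} [NeZero t] {w : V} (c : G.Walk w w) (hc : Odd c.length) :
    3 ≤ (G.lexProduct (nullGraph t)).localAntimagicChromaticNumber := by
  refine le_iInf₂ fun f hf => ?_
  by_contra hlt
  have hfin : (Set.range ((G.lexProduct (nullGraph t)).inducedColor f)).Finite :=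
    Set.finite_range _
  have hcard : (Set.range ((G.lexProduct (nullGraph t)).inducedColor f)).ncard ≤ 2 := by
    rw [not_le] at hlt
    have : (Set.range ((G.lexProduct (nullGraph t)).inducedColor f)).ncard < 3 := by
      exact_mod_cast hlt
    omega
  have := hfin.fintype
  let C : G.Coloring (Set.range ((G.lexProduct (nullGraph t)).inducedColor f)) :=
    Coloring.mk (fun v => ⟨_, Set.mem_range_self (v, 0)⟩) fun {u v} h he =>
      hf.color_ne (lexProduct_nullGraph_adj.2 h : (G.lexProduct (nullGraph t)).Adj (u, 0) (v, 0))
        (congrArg Subtype.val he)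
  have h2 : G.Colorable 2 := C.colorable.mono (by
    rwa [← Nat.card_eq_fintype_card, Nat.card_coe_set_eq])
  exact Nat.not_even_iff_odd.2 hc (two_colorable_iff_forall_loop_even.1 h2 w c)

/-! ### Separating the three colours (`T` stands for `t ^ 2`) -/

/-- Modulo `T * q + 1` an equality would give `n * T ≡ 0`, but `0 < n * T < T * q + 1`. -/
theorem color_left_ne_right {T q m n : ℤ} (hT : 9 ≤ T) (hn : 0 < n) (hnq : n < q) :
    m * (T * q + 1) ≠ n * (T * q + T + 1) := by
  intro h
  have h₀ : n * T = 0 := by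
    refine Int.eq_zero_of_abs_lt_dvd (m := T * q + 1) ⟨m - n, by linear_combination -h⟩ ?_
    rw [abs_of_nonneg (by positivity)]
    nlinarith
  nlinarith

/-- Modulo `T * q + 1` the difference of the sides is `(2 * a + 1) * T + 1`, strictly between `0`
and the modulus. -/
theorem color_base_ne_left {T q a b m : ℤ} (hT : 9 ≤ T) (ha : 0 ≤ a) (haq : 2 * a + 1 < q) :
    -(T * q) + (2 * a + 1) * (T * q + T + 1) + (2 * b + 1) * (T * q + 1) ≠
      2 * m * (T * q + 1) := by
  intro h
  have h₀ : (2 * a + 1) * T + 1 = 0 := by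
    refine Int.eq_zero_of_abs_lt_dvd (m := T * q + 1) ⟨2 * m - 2 * a - 2 * b - 1,
      by linear_combination h⟩ ?_
    rw [abs_of_nonneg (by positivity)]
    nlinarith
  nlinarith

/-- Modulo `T * q + T + 1` the difference of the sides is `1 - 2 * b * T`, nonzero and of absolute
value below the modulus. -/
theorem color_base_ne_right {T q a b n : ℤ} (hT : 9 ≤ T) (hb : 0 ≤ b) (hbq : 2 * b + 1 < q) :
    -(T * q) + (2 * a + 1) * (T * q + T + 1) + (2 * b + 1) * (T * q + 1) ≠
      2 * n * (T * q + T + 1) := by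
  intro h
  have h₀ : 1 - 2 * b * T = 0 := by
    refine Int.eq_zero_of_abs_lt_dvd (m := T * q + T + 1) ⟨2 * n - 2 * a - 2 * b - 1,
      by linear_combination h⟩ ?_
    rw [abs_lt]
    constructor <;> nlinarith
  rcases hb.eq_or_lt with rfl | hb <;> nlinarith

/-! ### Trail and numbering for the given graph -/

namespace IsOddEulerianTripartite

variable {V : Type*} [Fintype V] [DecidableEq V] {G : SimpleGraph V} [DecidableRel G.Adj] {w : V}
  {V₂ V₃ : Finset V} {a b m n : ℕ}

theorem eq_or_mem (hG : G.IsOddEulerianTripartite w V₂ V₃ a b m n) (u : V) :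
    u = w ∨ u ∈ V₂ ∨ u ∈ V₃ := by
  have := hG.cover ▸ Finset.mem_univ u
  simpa [or_assoc] using this

theorem mem_left_iff (hG : G.IsOddEulerianTripartite w V₂ V₃ a b m n) {u v : V} (h : G.Adj u v)
    (hu : u ≠ w) (hv : v ≠ w) : u ∈ V₂ ↔ v ∉ V₂ := by
  have h₂ := hG.indep_left
  have h₃ := hG.indep_right
  have hu' := (hG.eq_or_mem u).resolve_left hu
  have hv' := (hG.eq_or_mem v).resolve_left hv
  constructor
  · exact fun h' h'' => h₂ (Finset.mem_coe.2 h') (Finset.mem_coe.2 h'') h.ne h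
  · intro h'
    refine hu'.resolve_right fun h'' => ?_
    exact h₃ h'' (hv'.resolve_left h') h.ne h

-- The circuit `c` is kept for the lower bound; it is as long as the trail, whose ends have
-- different colours.
open Classical in
theorem exists_isParityTrail (hG : G.IsOddEulerianTripartite w V₂ V₃ a b m n) :
    ∃ (c : G.Walk w w) (q : ℕ) (x : ℕ → V × Bool), Odd c.length ∧
      G.IsParityTrail w (V₂ : Set V) q x := by
  obtain ⟨hconn, v, c₀, hc₀⟩ := hG.eulerian
  have hw : w ∈ c₀.support := by
    obtain ⟨x, hx⟩ : (G.neighborFinset w ∩ V₂).Nonempty := by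
      rw [← Finset.card_pos, hG.card_left]
      omega
    rw [Finset.mem_inter, mem_neighborFinset] at hx
    exact c₀.fst_mem_support_of_mem_edges (hc₀.mem_edges_iff.2 hx.1)
  set c := c₀.rotate w hw
  have hc : c.IsEulerian := fun e he => by
    rw [(c₀.rotate_edges w hw).perm.count_eq]
    exact hc₀ e he
  have hcount : c.edges.countP (fun e => w ∈ e ∧ ∃ x ∈ (V₂ : Set V), x ≠ w ∧ x ∈ e) =
      2 * a + 1 := by
    rw [← hG.card_left, List.countP_eq_length_filter,
      ← List.toFinset_card_of_nodup (hc.isTrail.edges_nodup.filter _)]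
    symm
    refine Finset.card_bij (fun x _ => s(w, x)) ?_ ?_ ?_
    · intro x hx
      rw [Finset.mem_inter, mem_neighborFinset] at hx
      simp only [List.mem_toFinset, List.mem_filter, hc.mem_edges_iff, decide_eq_true_eq]
      exact ⟨hx.1, Sym2.mem_mk_left _ _, x, hx.2, hx.1.ne', Sym2.mem_mk_right _ _⟩
    · intro x _ y _ h
      exact Sym2.congr_right.1 h
    · intro e he
      simp only [List.mem_toFinset, List.mem_filter, hc.mem_edges_iff, decide_eq_true_eq] at he
      obtain ⟨he, hwe, x, hx, hxw, hxe⟩ := he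
      have : e = s(w, x) := (Sym2.mem_and_mem_iff hxw.symm).1 ⟨hwe, hxe⟩
      subst this
      exact ⟨x, by rw [Finset.mem_inter, mem_neighborFinset]; exact ⟨he, hx⟩, rfl⟩
  have hodd : Odd (2 * a + 1) := by simp
  rw [← hcount] at hodd
  obtain ⟨p, hp⟩ := exists_walk_parityLift (X := (V₂ : Set V))
    (fun u v h hu hv => by simpa using hG.mem_left_iff h hu hv) c (by convert hodd)
  have ht := isParityTrail_of_perm hc hp
  refine ⟨c, _, _, ?_, ht⟩
  have := hp.length_eq
  rw [projEdges, List.length_map, Walk.length_edges, Walk.length_edges] at this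
  rw [this, Nat.odd_iff]
  exact ht.odd

open Classical in
/-- An edge numbering for which the sum at a vertex depends only on the partite set. -/
theorem exists_numbering (hG : G.IsOddEulerianTripartite w V₂ V₃ a b m n) {q : ℕ}
    {x : ℕ → V × Bool} (hx : G.IsParityTrail w (V₂ : Set V) q x) :
    ∃ k : Sym2 V → ℕ, Set.BijOn k G.edgeSet (Set.Iio q) ∧
      (∀ u ∈ V₂, 2 * ∑ v ∈ G.neighborFinset u, (k s(u, v) : ℤ) = 2 * m * (q - 1)) ∧
      (∀ u ∈ V₃, 2 * ∑ v ∈ G.neighborFinset u, (k s(u, v) : ℤ) = 2 * n * q) ∧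
      2 * ∑ v ∈ G.neighborFinset w, (k s(w, v) : ℤ) =
        (2 * a + 1) * q + (2 * b + 1) * (q - 1) - q := by
  obtain ⟨k, hk, hsum⟩ := hx.exists_numbering
  have hV₃ : ∀ u, u ∈ V₃ → u ∉ V₂ ∧ u ≠ w := fun u hu =>
    ⟨fun h => Finset.disjoint_left.1 hG.disjoint h hu, fun h => hG.notMem_right (h ▸ hu)⟩
  have hlift : ∀ u, u ≠ w → (Finset.univ.filter fun v =>
      (G.parityLift w (V₂ : Set V)).Adj (u, decide (u ∈ V₂)) (v, !decide (u ∈ V₂))) =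
      G.neighborFinset u := by
    intro u hu
    ext v
    rw [Finset.mem_filter, and_iff_right (Finset.mem_univ v), mem_neighborFinset]
    refine ⟨fun h => h.1, fun h => ⟨h, by simp, by simp, fun hv => ?_⟩⟩
    have := hG.mem_left_iff h hu hv
    simp [this]
  -- The lift splits the edges at `w`: those to `V₂` sit at `(w, false)`, those to `V₃` at `(w,
  -- true)`.
  have hfalse : (Finset.univ.filter fun v =>
      (G.parityLift w (V₂ : Set V)).Adj (w, false) (v, !false)) = G.neighborFinset w ∩ V₂ := by
    ext v
    rw [Finset.mem_filter, and_iff_right (Finset.mem_univ v), Finset.mem_inter,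
      mem_neighborFinset]
    refine ⟨fun h => ⟨h.1, by simpa using h.2.2.2 h.1.ne'⟩, fun h => ⟨h.1, by simp, by simp, ?_⟩⟩
    simp [h.2]
  have htrue : (Finset.univ.filter fun v =>
      (G.parityLift w (V₂ : Set V)).Adj (w, true) (v, !true)) = G.neighborFinset w ∩ V₃ := by
    ext v
    rw [Finset.mem_filter, and_iff_right (Finset.mem_univ v), Finset.mem_inter,
      mem_neighborFinset]
    refine ⟨fun h => ⟨h.1, ?_⟩, fun h => ⟨h.1, by simp, by simp, ?_⟩⟩
    · have := h.2.2.2 h.1.ne'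
      exact ((hG.eq_or_mem v).resolve_left h.1.ne').resolve_left (by simpa using this)
    · simp [(hV₃ v h.2).1]
  have hsplit : G.neighborFinset w = (G.neighborFinset w ∩ V₂) ∪ (G.neighborFinset w ∩ V₃) := by
    ext v
    simp only [Finset.mem_union, Finset.mem_inter, mem_neighborFinset]
    refine ⟨fun h => ?_, fun h => h.elim And.left And.left⟩
    exact ((hG.eq_or_mem v).resolve_left h.ne').imp (⟨h, ·⟩) (⟨h, ·⟩)
  refine ⟨k, hk, fun u hu => ?_, fun u hu => ?_, ?_⟩
  · have huw : u ≠ w := fun h => hG.notMem_left (h ▸ hu)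
    have h := hsum u (decide (u ∈ V₂))
    rw [hlift u huw, Finset.sum_sub_distrib, ← Finset.mul_sum] at h
    simp only [hu, huw, decide_true, if_true, false_and, if_false, Finset.sum_const,
      card_neighborFinset_eq_degree, hG.degree_left u hu, nsmul_eq_mul] at h
    push_cast at h
    linear_combination h
  · obtain ⟨hu₂, huw⟩ := hV₃ u hu
    have h := hsum u (decide (u ∈ V₂))
    rw [hlift u huw, Finset.sum_sub_distrib, ← Finset.mul_sum] at h
    simp only [hu₂, huw, decide_false, Bool.false_eq_true, false_and, if_false, Finset.sum_const,
      card_neighborFinset_eq_degree, hG.degree_right u hu, nsmul_eq_mul] at h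
    push_cast at h
    linear_combination h
  · have h₁ := hsum w false
    have h₂ := hsum w true
    rw [hfalse, Finset.sum_sub_distrib, ← Finset.mul_sum] at h₁
    rw [htrue, Finset.sum_sub_distrib, ← Finset.mul_sum] at h₂
    simp only [Finset.sum_const, hG.card_left, hG.card_right, nsmul_eq_mul, if_true,
      Bool.false_eq_true, if_false, and_false, and_true, Bool.true_eq_false] at h₁ h₂
    push_cast at h₁ h₂
    rw [hsplit, Finset.sum_union]
    · linear_combination h₁ + h₂
    · exact hG.disjoint.mono Finset.inter_subset_right Finset.inter_subset_right

theorem degree_base (hG : G.IsOddEulerianTripartite w V₂ V₃ a b m n) :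
    G.degree w = (2 * a + 1) + (2 * b + 1) := by
  rw [← hG.card_left, ← hG.card_right, ← card_neighborFinset_eq_degree,
    ← Finset.card_union_of_disjoint
      (hG.disjoint.mono Finset.inter_subset_right Finset.inter_subset_right)]
  congr 1
  ext v
  simp only [Finset.mem_union, Finset.mem_inter, mem_neighborFinset]
  refine ⟨fun h => ?_, fun h => h.elim And.left And.left⟩
  exact ((hG.eq_or_mem v).resolve_left h.ne').imp (⟨h, ·⟩) (⟨h, ·⟩)

end IsOddEulerianTripartite

theorem degree_le_of_bijOn {V : Type*} [Fintype V] {G : SimpleGraph V}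
    [DecidableRel G.Adj] {k : Sym2 V → ℕ} {q : ℕ} (hk : Set.BijOn k G.edgeSet (Set.Iio q)) (u : V) :
    G.degree u ≤ q := by
  rw [← card_neighborFinset_eq_degree, ← Finset.card_range q]
  refine Finset.card_le_card_of_injOn (fun v => k s(u, v)) ?_ ?_
  · intro v hv
    simpa using hk.mapsTo (show s(u, v) ∈ G.edgeSet by simpa using hv)
  · intro v hv v' hv' h
    exact Sym2.congr_right.1 (hk.injOn (show s(u, v) ∈ G.edgeSet by simpa using hv)
      (show s(u, v') ∈ G.edgeSet by simpa using hv') h)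

end SimpleGraph

/-! ### The main theorem -/

open SimpleGraph in
theorem mainTheorem7 {V : Type*} [Fintype V] [DecidableEq V] (G : SimpleGraph V)
    [DecidableRel G.Adj] (w : V) (V₂ V₃ : Finset V) (a b m n : ℕ)
    (hG : G.IsOddEulerianTripartite w V₂ V₃ a b m n) (t : ℕ) (ht : 3 ≤ t) :
    (G.lexProduct (SimpleGraph.nullGraph t)).localAntimagicChromaticNumber = 3 := by
  have : NeZero t := ⟨by omega⟩
  obtain ⟨c, q, x, hc, hx⟩ := hG.exists_isParityTrail
  refine le_antisymm ?_ (three_le_localAntimagicChromaticNumber_lexProduct c hc)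
  obtain ⟨k, hk, hleft, hright, hbase⟩ := hG.exists_numbering hx
  obtain ⟨f, hf, hcolor⟩ := exists_labeling_lexProduct hk ht
  set H := G.lexProduct (nullGraph t) with hH
  have hcolor' : ∀ (u : V) (i : Fin t), 2 * (H.inducedColor f (u, i) : ℤ) =
      t ^ 3 * (2 * ∑ v ∈ G.neighborFinset u, (k s(u, v) : ℤ)) +
        G.degree u * (t * (t ^ 2 + 1)) := by
    intro u i
    have h := hcolor u i
    zify at h
    rw [h, Finset.sum_add_distrib, Finset.sum_const, ← Finset.mul_sum, nsmul_eq_mul,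
      ← card_neighborFinset_eq_degree]
    have : ∀ inst : DecidablePred fun v => G.Adj u v,
        (@Finset.filter _ (fun v => G.Adj u v) inst Finset.univ) = G.neighborFinset u := by
      intro _
      ext v
      simp
    rw [this _]
    ring
  have hdeg := degree_le_of_bijOn hk
  have hw := hdeg w
  rw [hG.degree_base] at hw
  -- `2 * n` is the degree of a neighbour of `w`, hence positive and at most `q`.
  have hn : 0 < n ∧ n < q := by
    obtain ⟨v, hv⟩ : (G.neighborFinset w ∩ V₃).Nonempty := by
      rw [← Finset.card_pos, hG.card_right]
      omega
    rw [Finset.mem_inter, mem_neighborFinset] at hv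
    have h₁ := hG.degree_right v hv.2
    have h₂ : 0 < G.degree v := (G.degree_pos_iff_exists_adj v).2 ⟨w, hv.1.symm⟩
    have h₃ := hdeg v
    omega
  have htpos : (0 : ℤ) < t := by exact_mod_cast (by omega : 0 < t)
  have hT : (9 : ℤ) ≤ (t : ℤ) ^ 2 := by
    have : (3 : ℤ) ≤ t := by exact_mod_cast ht
    nlinarith
  have c₂ : ∀ u ∈ V₂, ∀ i, (H.inducedColor f (u, i) : ℤ) = t * (m * (t ^ 2 * q + 1)) := by
    intro u hu i
    have h := hcolor' u i
    rw [hleft u hu, hG.degree_left u hu] at h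
    push_cast at h
    refine mul_left_cancel₀ two_ne_zero ?_
    linear_combination h
  have c₃ : ∀ u ∈ V₃, ∀ i, (H.inducedColor f (u, i) : ℤ) =
      t * (n * (t ^ 2 * q + t ^ 2 + 1)) := by
    intro u hu i
    have h := hcolor' u i
    rw [hright u hu, hG.degree_right u hu] at h
    push_cast at h
    refine mul_left_cancel₀ two_ne_zero ?_
    linear_combination h
  have c₁ : ∀ i, 2 * (H.inducedColor f (w, i) : ℤ) = t * (-(t ^ 2 * q) +
      (2 * a + 1) * (t ^ 2 * q + t ^ 2 + 1) + (2 * b + 1) * (t ^ 2 * q + 1)) := by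
    intro i
    have h := hcolor' w i
    rw [hbase, hG.degree_base] at h
    push_cast at h
    linear_combination h
  have ne₂₃ : ∀ u ∈ V₂, ∀ v ∈ V₃, ∀ i j,
      H.inducedColor f (u, i) ≠ H.inducedColor f (v, j) := by
    intro u hu v hv i j h
    zify at h
    rw [c₂ u hu, c₃ v hv] at h
    exact color_left_ne_right hT (by exact_mod_cast hn.1) (by exact_mod_cast hn.2)
      (mul_left_cancel₀ htpos.ne' h)
  have ne₁₂ : ∀ u ∈ V₂, ∀ i j, H.inducedColor f (w, i) ≠ H.inducedColor f (u, j) := by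
    intro u hu i j h
    zify at h
    have h₁ := c₁ i
    rw [h, c₂ u hu] at h₁
    refine color_base_ne_left (a := a) (b := b) (m := m) (q := q) hT (by positivity) (by omega)
      (mul_left_cancel₀ htpos.ne' ?_)
    linear_combination -h₁
  have ne₁₃ : ∀ u ∈ V₃, ∀ i j, H.inducedColor f (w, i) ≠ H.inducedColor f (u, j) := by
    intro u hu i j h
    zify at h
    have h₁ := c₁ i
    rw [h, c₃ u hu] at h₁
    refine color_base_ne_right (a := a) (b := b) (n := n) (q := q) hT (by positivity) (by omega)
      (mul_left_cancel₀ htpos.ne' ?_)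
    linear_combination -h₁
  have hlabel : H.IsLocalAntimagicLabeling f := by
    refine ⟨?_, ?_⟩
    · have hcard : H.edgeSet.ncard = t ^ 2 * q := by
        rw [← hf.injOn.ncard_image, hf.image_eq, ← Nat.card_coe_set_eq, Nat.card_eq_fintype_card]
        simp
      rwa [hcard]
    · rintro ⟨u, i⟩ ⟨v, j⟩ h
      have h' : G.Adj u v := lexProduct_nullGraph_adj.1 h
      rcases hG.eq_or_mem u with rfl | hu | hu
      · rcases hG.eq_or_mem v with rfl | hv | hv
        · exact absurd rfl h'.ne
        · exact ne₁₂ v hv i j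
        · exact ne₁₃ v hv i j
      · rcases hG.eq_or_mem v with rfl | hv | hv
        · exact (ne₁₂ u hu j i).symm
        · exact absurd h' (hG.indep_left hu hv h'.ne)
        · exact ne₂₃ u hu v hv i j
      · rcases hG.eq_or_mem v with rfl | hv | hv
        · exact (ne₁₃ u hu j i).symm
        · exact (ne₂₃ v hv u hu j i).symm
        · exact absurd h' (hG.indep_right hu hv h'.ne)
  refine (iInf₂_le f hlabel).trans ?_
  obtain ⟨u₂, hu₂⟩ := Finset.card_pos.1 (by have := hG.two_le_left; omega : 0 < V₂.card)
  obtain ⟨u₃, hu₃⟩ := Finset.card_pos.1 (by have := hG.two_le_right; omega : 0 < V₃.card)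
  have hsub : Set.range (H.inducedColor f) ⊆ (({H.inducedColor f (w, 0),
      H.inducedColor f (u₂, 0), H.inducedColor f (u₃, 0)} : Finset ℕ) : Set ℕ) := by
    rintro _ ⟨⟨u, i⟩, rfl⟩
    simp only [Finset.coe_insert, Finset.coe_singleton, Set.mem_insert_iff, Set.mem_singleton_iff]
    rcases hG.eq_or_mem u with rfl | hu | hu
    · have h₁ := c₁ i
      have h₂ := c₁ 0
      left
      apply Nat.cast_injective (R := ℤ)
      refine mul_left_cancel₀ two_ne_zero ?_
      linear_combination h₁ - h₂
    · right; left
      apply Nat.cast_injective (R := ℤ)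
      rw [c₂ u hu, c₂ u₂ hu₂]
    · right; right
      apply Nat.cast_injective (R := ℤ)
      rw [c₃ u hu, c₃ u₃ hu₃]
  have hle := (Set.ncard_le_ncard hsub (Finset.finite_toSet _)).trans
    ((Set.ncard_coe_finset _).trans_le Finset.card_le_three)
  exact_mod_cast hle
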